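/- Let $\Theta=\mathbb B^d$ be the closed Euclidean unit ball of $\mathbb R^d$, $d\ge 1$. In each round $t=1,\dots,T$ a learner plays $z_t\in\Theta$ and observes $y_t=f_t(z_t)+\xi_t$. The noise variables $\xi_t$ are independent with common law $F$, and for some $0<I_0<\infty$ and $0<v_0\le\infty$, $$\int \log\frac{dF(u)}{dF(u+v)}\,dF(u)\le I_0v^2\qquad\text{for all } |v|<v_0 ,$$ that is, the Kullback–Leibler divergence of $F$ from its translate by $v$ is at most $I_0v^2$. A randomized algorithm chooses $z_t=\Phi_t(u,z_1,y_1,\dots,z_{t-1},y_{t-1})\in\Theta$ with Borel maps $\Phi_t$ and a random seed $u$ (of any law, in any measurable space) that is independent of the noise. For $0<\alpha<\beta$ and $B>\alpha/4$ let $\mathcal F$ be the class of functions $f:\mathbb R^d\to\mathbb R$ that are $\alpha$-strongly convex (differentiable with $f(z)\ge f(x)+\langle\nabla f(x),z-x\rangle+\frac\alpha2\|z-x\|^2$ for all $x,z$) and $\beta$-smooth ($C^1$ with $\beta$-Lipschitz gradient), satisfy $|f|\le B$ on $\Theta$, and have their minimizer over $\mathbb R^d$ in $\Theta$. (With the normalization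 $B=1$ the condition on $\alpha$ is $\alpha<4$.) For an algorithm, put $$R^{\mathrm{dyn}}(T,\Delta,S)=\sup_{f_1,\dots,f_T}\ \sum_{t=1}^T\mathbb E\Big[f_t(z_t)-\min_{z\in\Theta}f_t(z)\Big],$$ where the supremum is over all $f_1,\dots,f_T\in\mathcal F$ such that $\sum_{t=2}^T\max_{z\in\Theta}|f_t(z)-f_{t-1}(z)|\le\Delta$ and $1+\sum_{t=2}^T\min\mathbf 1(z_t^*\ne z_{t-1}^*)\le S$, the inner minimum being over $z_t^*\in\arg\min_\Theta f_t$ and $z_{t-1}^*\in\arg\min_\Theta f_{t-1}$. Theorem. There is a constant $c>0$ that depends only on $\alpha,\beta,B,I_0,v_0$ such that for every such noise law $F$, all integers $d,T,S\ge1$, every real $\Delta\ge0$ and every randomized algorithm, $$R^{\mathrm{dyn}}(T,\Delta,S)\ \ge\ c\,\min\{T,\ d\sqrt{ST},\ d^{2/3}\Delta^{1/3}T^{2/3}\}.$$ In particular, whenever $T\ge T_0:=d^2\min(S,\Delta)$, $$R^{\mathrm{dyn}}(T,\Delta,S)\ \ge\ c\,\min\{d\sqrt{ST},\ d^{2/3}\Delta^{1/3}T^{2/3}\}.$$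 -/

import Mathlib

open MeasureTheory ProbabilityTheory InformationTheory
open scoped ENNReal RealInnerProductSpace Gradient

noncomputable section

namespace BanditLB

/-- The ambient Euclidean space of dimension `d`. -/
abbrev E (d : ℕ) : Type := EuclideanSpace ℝ (Fin d)

/-- The action set: the closed Euclidean unit ball. -/
def Ball (d : ℕ) : Set (E d) := Metric.closedBall 0 1

/-! ### Loss functions -/

/-- A differentiable function is `α`-strongly convex if it lies above its tangents by at least
`α / 2` times the squared distance. -/
def StronglyConvex {d : ℕ} (α : ℝ) (f : E d → ℝ) : Prop :=
  Differentiable ℝ f ∧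
    ∀ x z : E d, f x + ⟪∇ f x, z - x⟫ + α / 2 * ‖z - x‖ ^ 2 ≤ f z

/-- `β`-smoothness: continuously differentiable with `β`-Lipschitz gradient. -/
def Smooth {d : ℕ} (β : ℝ) (f : E d → ℝ) : Prop :=
  ContDiff ℝ 1 f ∧ ∀ x z : E d, ‖∇ f x - ∇ f z‖ ≤ β * ‖x - z‖

/-- The class of admissible losses: `α`-strongly convex and `β`-smooth on the whole space, bounded
by `B` in absolute value on the ball, with the global minimizer in the ball. -/
structure IsLoss {d : ℕ} (α β B : ℝ) (f : E d → ℝ) : Prop where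
  stronglyConvex : StronglyConvex α f
  smooth : Smooth β f
  bounded : ∀ x ∈ Ball d, |f x| ≤ B
  minimizer_mem : ∃ x ∈ Ball d, ∀ z, f x ≤ f z

/-! ### Non-stationarity of a loss sequence

Rounds are numbered from `0`, so the rounds of a game with horizon `T` are `0, …, T - 1`. -/

/-- The set of minimizers of `f` over the ball. -/
def argminSet {d : ℕ} (f : E d → ℝ) : Set (E d) :=
  {x | x ∈ Ball d ∧ ∀ z ∈ Ball d, f x ≤ f z}

open Classical in
/-- One plus the number of consecutive rounds whose minimizers have to differ: the smallest value
of the indicator of `x ≠ x'`, over minimizers `x` and `x'` of the two losses, is `0` exactly when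
the two sets of minimizers meet. -/
def numSwitches {d : ℕ} (T : ℕ) (f : ℕ → E d → ℝ) : ℕ :=
  1 + ∑ t ∈ Finset.range (T - 1),
    if (argminSet (f t) ∩ argminSet (f (t + 1))).Nonempty then 0 else 1

/-- Total variation: the sum over consecutive rounds of `max |f_{t+1} - f_t|` over the ball. -/
def totalVariation {d : ℕ} (T : ℕ) (f : ℕ → E d → ℝ) : ℝ :=
  ∑ t ∈ Finset.range (T - 1), sSup ((fun z => |f (t + 1) z - f t z|) '' Ball d)

/-- Environments with horizon `T`, total variation at most `Δ`, and at most `S` switches. -/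
structure IsEnvironment {d : ℕ} (α β B : ℝ) (T S : ℕ) (Δ : ℝ) (f : ℕ → E d → ℝ) : Prop where
  isLoss : ∀ t < T, IsLoss α β B (f t)
  totalVariation_le : totalVariation T f ≤ Δ
  numSwitches_le : numSwitches T f ≤ S

/-! ### Algorithms and their interaction with an environment -/

/-- A randomized algorithm: an internal random seed, drawn once and independently of the noise, and
for every round `t` a Borel map that sends the seed and the `t` past pairs (action, feedback) to
the next action, a point of the ball. -/
structure RandomizedAlgorithm (d : ℕ) (U : Type*) [MeasurableSpace U] where
  seedLaw : Measure U
  isProbabilityMeasure : IsProbabilityMeasure seedLaw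
  act : (t : ℕ) → U → (Fin t → E d × ℝ) → E d
  measurable_act : ∀ t, Measurable (fun p : U × (Fin t → E d × ℝ) => act t p.1 p.2)
  act_mem : ∀ t u H, act t u H ∈ Ball d

attribute [instance] RandomizedAlgorithm.isProbabilityMeasure

variable {d : ℕ} {U : Type*} [MeasurableSpace U]

/-- The pairs (action, feedback) of the first `t` rounds, for the seed `u` and the noise `ξ`: in
round `s` the algorithm plays `z` and observes `f s z + ξ s`. -/
def history (A : RandomizedAlgorithm d U) (f : ℕ → E d → ℝ) (u : U) (ξ : ℕ → ℝ) :
    (t : ℕ) → (Fin t → E d × ℝ)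
  | 0 => Fin.elim0
  | t + 1 =>
    let H := history A f u ξ t
    let z := A.act t u H
    Fin.snoc (α := fun _ => E d × ℝ) H (z, f t z + ξ t)

/-- The action played in round `t`. -/
def action (A : RandomizedAlgorithm d U) (f : ℕ → E d → ℝ) (u : U) (ξ : ℕ → ℝ) (t : ℕ) : E d :=
  A.act t u (history A f u ξ t)

/-- The expected dynamic regret over `T` rounds in the environment `f`, when the noise variables are
independent with law `F` and independent of the seed. -/
def regret (A : RandomizedAlgorithm d U) (F : Measure ℝ) [IsProbabilityMeasure F] (T : ℕ)
    (f : ℕ → E d → ℝ) : ℝ :=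
  ∑ t ∈ Finset.range T,
    ∫ ω : U × (ℕ → ℝ), (f t (action A f ω.1 ω.2 t) - sInf (f t '' Ball d))
      ∂(A.seedLaw.prod (Measure.infinitePi (fun _ : ℕ => F)))

/-- The worst-case dynamic regret: the supremum over all environments with horizon `T`, total
variation at most `Δ` and at most `S` switches, taken in the extended reals. -/
def dynRegret (A : RandomizedAlgorithm d U) (F : Measure ℝ) [IsProbabilityMeasure F]
    (α β B : ℝ) (T S : ℕ) (Δ : ℝ) : EReal :=
  ⨆ (f : ℕ → E d → ℝ) (_ : IsEnvironment α β B T S Δ f), ((regret A F T f : ℝ) : EReal)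

/-! ### Noise -/

/-- The Kullback–Leibler divergence of the noise law `F` from its translate `dF(u + v)` (the law of
`ξ - v` for `ξ` of law `F`) is at most `I₀ v²` for all `|v| < v₀`, where `v₀` may be infinite. -/
def KLCondition (F : Measure ℝ) (I₀ : ℝ) (v₀ : ℝ≥0∞) : Prop :=
  ∀ v : ℝ, ‖v‖ₑ < v₀ → klDiv F (F.map (fun u => u - v)) ≤ ENNReal.ofReal (I₀ * v ^ 2)

end BanditLB

end

/-!
The hard instances are the losses `∑ i, (a / 2 * zᵢ ^ 2 - κ * μ ^ 2 * (σᵢ * sin (zᵢ / μ)))` with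
signs `σᵢ = ±1`. Whatever the wavelength `μ`, their second derivatives in each coordinate lie in
`[a - κ, a + κ] ⊆ [α, β]`, and the `i`-th coordinate of the minimizer is `σᵢ * y * μ`. Flipping one
sign thus moves the minimizer by `2 * y * μ`, but it changes the values of the loss by at most
`2 * κ * μ ^ 2`, so that over `n` rounds the Kullback–Leibler divergence between the two laws of the
feedback is at most `n * I₀ * (2 * κ * μ ^ 2) ^ 2`.

The rounds are divided into blocks of length `n`, with independent uniform signs on each block. If
`μ ^ 2` is a small multiple of `min (1 / d) (1 / √n)`, the learner cannot identify any sign, and Le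
Cam's two-point method in every round and every coordinate gives an average regret of order
`T * d * μ ^ 2`, which is of order `T * min 1 (d / √n)`. Two consecutive blocks differ by at most
`2 * κ * d * μ ^ 2` in sup norm; the constraints on the number of changes and on the total variation
determine the best `n`.
-/

namespace BanditLB

/-! ### Kullback–Leibler divergence -/

section KLDivergence

variable {X Y Z : Type*} [MeasurableSpace X] [MeasurableSpace Y] [MeasurableSpace Z]

lemma klDiv_compProd_right_eq_lintegral [MeasurableSpace.CountableOrCountablyGenerated X Y]
    {μ : Measure X} [IsFiniteMeasure μ] {κ η : Kernel X Y} [IsFiniteKernel κ] [IsFiniteKernel η]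
    (h_ac : ∀ᵐ x ∂μ, κ x ≪ η x) :
    klDiv (μ ⊗ₘ κ) (μ ⊗ₘ η) = ∫⁻ x, klDiv (κ x) (η x) ∂μ := by
  have h_density : μ ⊗ₘ κ = (μ ⊗ₘ η).withDensity (fun p => Kernel.rnDeriv κ η p.1 p.2) := by
    have h : ∀ᵐ x ∂μ, κ x = η.withDensity (Kernel.rnDeriv κ η) x := by
      filter_upwards [h_ac] with x hx using (Kernel.withDensity_rnDeriv_eq hx).symm
    rw [Measure.compProd_congr h, Measure.compProd_withDensity (Kernel.measurable_rnDeriv κ η)]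
  have h_rnDeriv :
      (μ ⊗ₘ κ).rnDeriv (μ ⊗ₘ η) =ᵐ[μ ⊗ₘ η] fun p => Kernel.rnDeriv κ η p.1 p.2 := by
    rw [h_density]
    exact Measure.rnDeriv_withDensity _ (Kernel.measurable_rnDeriv κ η)
  rw [klDiv_eq_lintegral_klFun_of_ac (Measure.absolutelyContinuous_compProd_right_iff.2 h_ac)]
  calc ∫⁻ p, ENNReal.ofReal (klFun ((μ ⊗ₘ κ).rnDeriv (μ ⊗ₘ η) p).toReal) ∂(μ ⊗ₘ η)
      = ∫⁻ p, ENNReal.ofReal (klFun (Kernel.rnDeriv κ η p.1 p.2).toReal) ∂(μ ⊗ₘ η) :=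
        lintegral_congr_ae (h_rnDeriv.fun_comp fun r => ENNReal.ofReal (klFun r.toReal))
    _ = ∫⁻ x, ∫⁻ y, ENNReal.ofReal (klFun (Kernel.rnDeriv κ η x y).toReal) ∂η x ∂μ := by
        refine Measure.lintegral_compProd ?_
        have := Kernel.measurable_rnDeriv κ η
        fun_prop
    _ = ∫⁻ x, klDiv (κ x) (η x) ∂μ := by
        refine lintegral_congr_ae ?_
        filter_upwards [h_ac] with x hx
        rw [klDiv_eq_lintegral_klFun_of_ac hx]
        exact lintegral_congr_ae (Kernel.rnDeriv_eq_rnDeriv_measure.fun_comp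
          fun r => ENNReal.ofReal (klFun r.toReal))

lemma klDiv_compProd_le_add [MeasurableSpace.CountableOrCountablyGenerated X Y]
    {μ ν : Measure X} [IsProbabilityMeasure μ] [IsFiniteMeasure ν] {κ η : Kernel X Y}
    [IsMarkovKernel κ] [IsMarkovKernel η] {k : ℝ≥0∞} (h : ∀ x, klDiv (κ x) (η x) ≤ k) :
    klDiv (μ ⊗ₘ κ) (ν ⊗ₘ η) ≤ klDiv μ ν + k := by
  rcases eq_or_ne k ∞ with rfl | hk
  · simp only [add_top, le_top]
  have h_ac : ∀ᵐ x ∂μ, κ x ≪ η x :=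
    ae_of_all _ fun x => (klDiv_ne_top_iff.1 (ne_top_of_le_ne_top hk (h x))).1
  rw [klDiv_compProd_eq_add μ ν κ η, klDiv_compProd_right_eq_lintegral h_ac]
  gcongr
  calc ∫⁻ x, klDiv (κ x) (η x) ∂μ ≤ ∫⁻ _, k ∂μ := lintegral_mono h
    _ = k := by rw [lintegral_const, measure_univ, mul_one]

lemma map_prodMk_prod_eq_compProd {μ : Measure X} [IsFiniteMeasure μ] {F : Measure Y}
    [IsFiniteMeasure F] {φ : X × Y → Z} (hφ : Measurable φ) :
    (μ.prod F).map (fun p => (p.1, φ p)) =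
      μ ⊗ₘ (Kernel.id ×ₖ Kernel.const X F).map φ := by
  have h_pair : Measurable fun p : X × Y => (p.1, φ p) := measurable_fst.prodMk hφ
  ext s hs
  rw [Measure.map_apply h_pair hs, Measure.prod_apply (h_pair hs), Measure.compProd_apply hs]
  refine lintegral_congr fun x => ?_
  rw [Kernel.map_apply' _ hφ _ (measurable_prodMk_left hs), Kernel.prod_apply, Kernel.id_apply,
    Kernel.const_apply, Measure.dirac_prod,
    Measure.map_apply measurable_prodMk_left (hφ (measurable_prodMk_left hs))]
  rfl

lemma klDiv_map_prodMk_prod_le [MeasurableSpace.CountableOrCountablyGenerated X Z]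
    {μ ν : Measure X} [IsProbabilityMeasure μ] [IsFiniteMeasure ν] {F : Measure Y}
    [IsProbabilityMeasure F] {φ ψ : X × Y → Z} (hφ : Measurable φ) (hψ : Measurable ψ) {k : ℝ≥0∞}
    (h : ∀ x, klDiv (F.map fun y => φ (x, y)) (F.map fun y => ψ (x, y)) ≤ k) :
    klDiv ((μ.prod F).map fun p => (p.1, φ p)) ((ν.prod F).map fun p => (p.1, ψ p)) ≤
      klDiv μ ν + k := by
  have h_apply {χ : X × Y → Z} (hχ : Measurable χ) (x : X) :
      (Kernel.id ×ₖ Kernel.const X F).map χ x = F.map fun y => χ (x, y) := by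
    rw [Kernel.map_apply _ hχ, Kernel.prod_apply, Kernel.id_apply, Kernel.const_apply,
      Measure.dirac_prod, Measure.map_map hχ measurable_prodMk_left]
    rfl
  have := Kernel.IsMarkovKernel.map (Kernel.id ×ₖ Kernel.const X F) hφ
  have := Kernel.IsMarkovKernel.map (Kernel.id ×ₖ Kernel.const X F) hψ
  rw [map_prodMk_prod_eq_compProd hφ, map_prodMk_prod_eq_compProd hψ]
  exact klDiv_compProd_le_add fun x => by simpa only [h_apply hφ, h_apply hψ] using h x

lemma le_klFun_add_two {x : ℝ} (hx : 0 ≤ x) : x ≤ klFun x + 2 := by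
  rcases hx.eq_or_lt with rfl | hx
  · simp only [klFun_zero]; norm_num
  have h_log : 1 - Real.exp 1 / x ≤ Real.log x - 1 := by
    have h := Real.one_sub_inv_le_log_of_pos (div_pos hx (Real.exp_pos 1))
    rwa [inv_div, Real.log_div hx.ne' (Real.exp_pos 1).ne', Real.log_exp] at h
  have h_mul : x - Real.exp 1 ≤ x * Real.log x - x := by
    calc x - Real.exp 1 = x * (1 - Real.exp 1 / x) := by field_simp
      _ ≤ x * (Real.log x - 1) := mul_le_mul_of_nonneg_left h_log hx.le
      _ = x * Real.log x - x := by ring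
  rw [klFun_apply]
  linarith [Real.exp_one_lt_three]

lemma measure_le_klDiv_add (P Q : Measure X) [IsFiniteMeasure P] [IsFiniteMeasure Q]
    (V : Set X) : P V ≤ klDiv P Q + 2 * Q V := by
  by_cases h_ac : P ≪ Q
  swap; · simp only [klDiv_of_not_ac h_ac, top_add, le_top]
  rw [klDiv_eq_lintegral_klFun_of_ac h_ac, ← Measure.setLIntegral_rnDeriv h_ac V]
  calc ∫⁻ x in V, P.rnDeriv Q x ∂Q
      ≤ ∫⁻ x in V, (ENNReal.ofReal (klFun (P.rnDeriv Q x).toReal) + 2) ∂Q := by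
        refine lintegral_mono_ae (ae_restrict_of_ae ?_)
        filter_upwards [Measure.rnDeriv_lt_top P Q] with x hx
        rw [← ENNReal.ofReal_toReal hx.ne, ENNReal.toReal_ofReal ENNReal.toReal_nonneg]
        refine (ENNReal.ofReal_le_ofReal (le_klFun_add_two ENNReal.toReal_nonneg)).trans ?_
        rw [ENNReal.ofReal_add (klFun_nonneg ENNReal.toReal_nonneg) zero_le_two,
          ENNReal.ofReal_ofNat]
    _ = ∫⁻ x in V, ENNReal.ofReal (klFun (P.rnDeriv Q x).toReal) ∂Q + 2 * Q V := by
        rw [lintegral_add_right _ measurable_const, setLIntegral_const]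
    _ ≤ ∫⁻ x, ENNReal.ofReal (klFun (P.rnDeriv Q x).toReal) ∂Q + 2 * Q V := by
        gcongr
        exact Measure.restrict_le_self

lemma sq_mul_measureReal_le_integral_dist_sq {M : Type*} [PseudoMetricSpace M] {P : Measure X}
    {f : X → M} {a : M} (h_int : Integrable (fun x => dist (f x) a ^ 2) P) {r : ℝ} (hr : 0 ≤ r) :
    r ^ 2 * P.real {x | r ≤ dist (f x) a} ≤ ∫ x, dist (f x) a ^ 2 ∂P := by
  have h := mul_meas_ge_le_integral_of_nonneg (ae_of_all _ fun x => sq_nonneg (dist (f x) a))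
    h_int (r ^ 2)
  simpa only [sq_le_sq₀ hr dist_nonneg] using h

/- Le Cam's two-point method: the events `r / 2 ≤ dist (f x) a` and `r / 2 ≤ dist (f x) b`, where
`r = dist a b`, cover the whole space. -/
lemma dist_sq_le_integral_add_integral_of_klDiv_le {M : Type*} [PseudoMetricSpace M]
    {P Q : Measure X} [IsProbabilityMeasure P] [IsProbabilityMeasure Q]
    (hPQ : klDiv P Q ≤ ENNReal.ofReal (1 / 2)) {f : X → M} {a b : M}
    (ha : Integrable (fun x => dist (f x) a ^ 2) P)
    (hb : Integrable (fun x => dist (f x) b ^ 2) Q) :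
    dist a b ^ 2 / 8 ≤ ∫ x, dist (f x) a ^ 2 ∂P + 2 * ∫ x, dist (f x) b ^ 2 ∂Q := by
  set r := dist a b / 2 with hr_def
  have hr : 0 ≤ r := by positivity
  set V := {x | r ≤ dist (f x) a}
  set W := {x | r ≤ dist (f x) b}
  have h_cover : V ∪ W = Set.univ := by
    refine Set.eq_univ_of_forall fun x => ?_
    by_contra! h
    simp only [V, W, Set.mem_union, Set.mem_ofPred_eq, not_or, not_le] at h
    linarith [dist_triangle_left a b (f x)]
  have h_one : 1 ≤ P.real V + P.real W := by
    simpa only [h_cover, probReal_univ] using measureReal_union_le (μ := P) V W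
  have h_transfer : P.real W ≤ 1 / 2 + 2 * Q.real W := by
    refine ENNReal.toReal_le_of_le_ofReal (by positivity) ?_
    calc P W ≤ klDiv P Q + 2 * Q W := measure_le_klDiv_add P Q W
      _ ≤ ENNReal.ofReal (1 / 2) + ENNReal.ofReal (2 * Q.real W) := by
        rw [ENNReal.ofReal_mul zero_le_two, ENNReal.ofReal_ofNat, ofReal_measureReal]
        gcongr
      _ = _ := (ENNReal.ofReal_add (by positivity) (by positivity)).symm
  have hV := sq_mul_measureReal_le_integral_dist_sq ha hr
  have hW := sq_mul_measureReal_le_integral_dist_sq hb hr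
  calc dist a b ^ 2 / 8 = r ^ 2 * (1 / 2) := by rw [hr_def]; ring
    _ ≤ r ^ 2 * (P.real V + 2 * Q.real W) := by gcongr; linarith
    _ ≤ _ := by linarith

end KLDivergence

/-! ### The law of the interaction -/

section Interaction

lemma map_restrict_eval_infinitePi {ι X : Type*} [MeasurableSpace X] (F : Measure X)
    [IsProbabilityMeasure F] {s : Finset ι} {i : ι} (hi : i ∉ s) :
    (Measure.infinitePi fun _ : ι => F).map (fun ξ => (s.restrict ξ, ξ i)) =
      ((Measure.infinitePi fun _ : ι => F).map s.restrict).prod F := by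
  have h_indep : IndepFun s.restrict (fun ξ : ι → X => ξ i) (Measure.infinitePi fun _ => F) :=
    ((iIndepFun_infinitePi (P := fun _ : ι => F) (X := fun _ x => x) fun _ => measurable_id)
      |>.indepFun_finset s {i} (Finset.disjoint_singleton_right.2 hi) measurable_pi_apply).comp
        measurable_id (measurable_pi_apply (X := fun _ : ({i} : Finset ι) => X) ⟨i, by simp⟩)
  rw [h_indep.map_prod_eq_prod_map_map (by fun_prop) (measurable_pi_apply i).aemeasurable,
    Measure.infinitePi_map_eval (fun _ => F)]

lemma map_prodMk_eval_prod_infinitePi {ι U X Y : Type*} [MeasurableSpace U] [MeasurableSpace X]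
    [MeasurableSpace Y] (P : Measure U) [IsFiniteMeasure P] (F : Measure X)
    [IsProbabilityMeasure F] {s : Finset ι} {i : ι} (hi : i ∉ s) {Ψ : U × (ι → X) → Y}
    (hΨ : Measurable Ψ) (hs : ∀ u, DependsOn (fun ξ => Ψ (u, ξ)) s) :
    (P.prod (Measure.infinitePi fun _ => F)).map (fun ω => (Ψ ω, ω.2 i)) =
      ((P.prod (Measure.infinitePi fun _ => F)).map Ψ).prod F := by
  classical
  obtain ⟨x₀⟩ := nonempty_of_isProbabilityMeasure F
  set N := Measure.infinitePi fun _ : ι => F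
  let Ψ' : U × (s → X) → Y := fun p => Ψ (p.1, Function.updateFinset (fun _ => x₀) s p.2)
  have hΨ' : Measurable Ψ' := hΨ.comp
    (measurable_fst.prodMk (measurable_updateFinset.comp measurable_snd))
  have h_factor : ∀ ω : U × (ι → X), Ψ ω = Ψ' (ω.1, s.restrict ω.2) := fun ω =>
    hs ω.1 fun j hj => by
      simp only [Function.updateFinset, Finset.mem_coe.1 hj, dite_true, Finset.restrict]
  have h_law : (P.prod N).map Ψ = (P.prod (N.map s.restrict)).map Ψ' := by
    rw [← Measure.map_id (μ := P), Measure.map_prod_map _ _ measurable_id (by fun_prop),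
      Measure.map_map hΨ' (by fun_prop), Measure.map_id]
    exact Measure.map_congr (ae_of_all _ h_factor)
  calc (P.prod N).map (fun ω => (Ψ ω, ω.2 i))
      = ((P.prod N).map (Prod.map id fun ξ => (s.restrict ξ, ξ i))).map
          (Prod.map Ψ' id ∘ MeasurableEquiv.prodAssoc.symm) := by
        rw [Measure.map_map (by fun_prop) (by fun_prop)]
        exact Measure.map_congr (ae_of_all _ fun ω => Prod.ext (h_factor ω) rfl)
    _ = ((P.prod (N.map s.restrict)).prod F).map (Prod.map Ψ' id) := by
        rw [← Measure.map_prod_map _ _ measurable_id (by fun_prop), Measure.map_id,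
          map_restrict_eval_infinitePi F hi, ← Measure.prodAssoc_prod,
          Measure.map_map (by fun_prop) (by fun_prop)]
        congr 1
    _ = ((P.prod N).map Ψ).prod F := by
        rw [h_law, ← Measure.map_prod_map _ _ hΨ' measurable_id, Measure.map_id]

lemma measurable_finSnoc {X : Type*} [MeasurableSpace X] (t : ℕ) :
    Measurable fun p : (Fin t → X) × X => Fin.snoc (α := fun _ => X) p.1 p.2 := by
  refine measurable_pi_iff.2 fun i => Fin.lastCases ?_ (fun j => ?_) i
  · simpa only [Fin.snoc_last] using measurable_snd
  · simpa only [Fin.snoc_castSucc, Function.comp_def] using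
      (measurable_pi_apply j).comp measurable_fst

variable {d : ℕ} {U : Type*} [MeasurableSpace U] (A : RandomizedAlgorithm d U) (F : Measure ℝ)
  [IsProbabilityMeasure F] {f f' : ℕ → E d → ℝ}

/-- The joint law of the seed and the noise, under which `regret` takes its expectations. -/
noncomputable abbrev gameMeasure : Measure (U × (ℕ → ℝ)) :=
  A.seedLaw.prod (Measure.infinitePi fun _ : ℕ => F)

/-- The joint law of the seed and the history before round `t`. The seed is included because, with
the history, it determines the next action. -/
noncomputable def historyLaw (f : ℕ → E d → ℝ) (t : ℕ) : Measure (U × (Fin t → E d × ℝ)) :=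
  (gameMeasure A F).map fun ω => (ω.1, history A f ω.1 ω.2 t)

/-- Adds the observation `p.2` of round `t` to the seed and the history `p.1`. -/
def appendObservation (t : ℕ) (p : (U × (Fin t → E d × ℝ)) × ℝ) :
    U × (Fin (t + 1) → E d × ℝ) :=
  (p.1.1, Fin.snoc (α := fun _ => E d × ℝ) p.1.2 (A.act t p.1.1 p.1.2, p.2))

/-- The feedback of round `t`, given the seed and the history `p.1` and the noise `p.2`. -/
def observation (f : ℕ → E d → ℝ) (t : ℕ) (p : (U × (Fin t → E d × ℝ)) × ℝ) : ℝ :=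
  f t (A.act t p.1.1 p.1.2) + p.2

variable {A}

lemma measurable_appendObservation (t : ℕ) : Measurable (appendObservation A t) := by
  have h_act : Measurable fun p : (U × (Fin t → E d × ℝ)) × ℝ => A.act t p.1.1 p.1.2 :=
    (A.measurable_act t).comp measurable_fst
  exact measurable_fst.fst.prodMk ((measurable_finSnoc t).comp
    (measurable_fst.snd.prodMk (h_act.prodMk measurable_snd)))

lemma measurable_observation (hf : ∀ t, Measurable (f t)) (t : ℕ) :
    Measurable (observation A f t) :=
  ((hf t).comp ((A.measurable_act t).comp measurable_fst)).add measurable_snd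

lemma prodMk_history_succ (ω : U × (ℕ → ℝ)) (t : ℕ) :
    (ω.1, history A f ω.1 ω.2 (t + 1)) = appendObservation A t ((ω.1, history A f ω.1 ω.2 t),
      observation A f t ((ω.1, history A f ω.1 ω.2 t), ω.2 t)) := rfl

lemma measurable_history (hf : ∀ t, Measurable (f t)) (t : ℕ) :
    Measurable fun ω : U × (ℕ → ℝ) => history A f ω.1 ω.2 t := by
  induction t with
  | zero => exact measurable_pi_iff.2 fun i => i.elim0
  | succ t ih =>
    have h_past := measurable_fst.prodMk ih
    exact measurable_snd.comp ((measurable_appendObservation t).comp (h_past.prodMk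
      ((measurable_observation hf t).comp
        (h_past.prodMk ((measurable_pi_apply t).comp measurable_snd)))))

lemma dependsOn_history (u : U) (t : ℕ) :
    DependsOn (fun ξ => history A f u ξ t) (Finset.range t) := by
  intro ξ ξ' h
  induction t with
  | zero => rfl
  | succ t ih =>
    have h_past : history A f u ξ t = history A f u ξ' t :=
      ih fun s hs => h s (Finset.mem_coe.2 (Finset.range_subset_range.2 t.le_succ hs))
    simp only [history, h_past, h t (Finset.mem_coe.2 (Finset.self_mem_range_succ t))]

lemma measurable_action (hf : ∀ t, Measurable (f t)) (t : ℕ) :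
    Measurable fun ω : U × (ℕ → ℝ) => action A f ω.1 ω.2 t :=
  (A.measurable_act t).comp (measurable_fst.prodMk (measurable_history hf t))

lemma isProbabilityMeasure_historyLaw (hf : ∀ t, Measurable (f t)) (t : ℕ) :
    IsProbabilityMeasure (historyLaw A F f t) :=
  Measure.isProbabilityMeasure_map
    (measurable_fst.prodMk (measurable_history hf t)).aemeasurable

lemma historyLaw_succ (hf : ∀ t, Measurable (f t)) (t : ℕ) :
    historyLaw A F f (t + 1) = (((historyLaw A F f t).prod F).map
      fun p => (p.1, observation A f t p)).map (appendObservation A t) := by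
  have h_past := measurable_fst.prodMk (measurable_history (A := A) hf t)
  have h_indep := map_prodMk_eval_prod_infinitePi A.seedLaw F Finset.notMem_range_self h_past
    fun u ξ ξ' h => Prod.ext rfl (dependsOn_history u t h)
  have h_obs := measurable_observation (A := A) hf t
  have h_append := measurable_appendObservation (A := A) t
  rw [historyLaw, historyLaw, ← h_indep, Measure.map_map h_append (by fun_prop),
    Measure.map_map (by fun_prop) (by fun_prop)]
  simp only [prodMk_history_succ]
  rfl

lemma klDiv_historyLaw_le (hf : ∀ t, Measurable (f t)) (hf' : ∀ t, Measurable (f' t))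
    (k : ℕ → ℝ≥0∞) (t : ℕ)
    (hk : ∀ s < t, ∀ z ∈ Ball d,
      klDiv (F.map fun x => f s z + x) (F.map fun x => f' s z + x) ≤ k s) :
    klDiv (historyLaw A F f t) (historyLaw A F f' t) ≤ ∑ s ∈ Finset.range t, k s := by
  have := fun s => isProbabilityMeasure_historyLaw (A := A) F hf s
  have := fun s => isProbabilityMeasure_historyLaw (A := A) F hf' s
  induction t with
  | zero =>
    have h_zero : historyLaw A F f 0 = historyLaw A F f' 0 := rfl
    simp only [h_zero, klDiv_self, zero_le]
  | succ t ih =>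
    rw [historyLaw_succ F hf, historyLaw_succ F hf', Finset.sum_range_succ]
    calc _ ≤ _ := klDiv_map_le _ _ (measurable_appendObservation t)
      _ ≤ klDiv (historyLaw A F f t) (historyLaw A F f' t) + k t :=
        klDiv_map_prodMk_prod_le (measurable_observation hf t) (measurable_observation hf' t)
          fun p => hk t t.lt_succ_self _ (A.act_mem t p.1 p.2)
      _ ≤ _ := by gcongr; exact ih fun s hs => hk s (hs.trans t.lt_succ_self)

/-- The mean squared distance between the `i`-th coordinate of the action of round `t` and `c`. -/
noncomputable def coordError (A : RandomizedAlgorithm d U) (F : Measure ℝ) (f : ℕ → E d → ℝ)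
    (t : ℕ) (i : Fin d) (c : ℝ) : ℝ :=
  ∫ ω, (action A f ω.1 ω.2 t i - c) ^ 2 ∂gameMeasure A F

lemma abs_apply_le_one_of_mem_ball {z : E d} (hz : z ∈ Ball d) (i : Fin d) : |z i| ≤ 1 :=
  (PiLp.norm_apply_le z i).trans (mem_closedBall_zero_iff.1 hz)

lemma integrable_sq_action_apply_sub (hf : ∀ t, Measurable (f t)) (t : ℕ) (i : Fin d) (c : ℝ) :
    Integrable (fun ω => (action A f ω.1 ω.2 t i - c) ^ 2) (gameMeasure A F) := by
  have h_meas : Measurable fun ω : U × (ℕ → ℝ) => (action A f ω.1 ω.2 t i - c) ^ 2 := by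
    have := measurable_action (A := A) hf t
    fun_prop
  refine .of_bound h_meas.aestronglyMeasurable ((1 + |c|) ^ 2) (ae_of_all _ fun ω => ?_)
  rw [Real.norm_eq_abs, abs_pow]
  have h_action := abs_apply_le_one_of_mem_ball (A.act_mem t ω.1 (history A f ω.1 ω.2 t)) i
  gcongr
  exact (abs_sub _ _).trans (by gcongr; exact h_action)

lemma sq_sub_le_coordError_add_coordError (hf : ∀ t, Measurable (f t))
    (hf' : ∀ t, Measurable (f' t)) {t : ℕ}
    (h : klDiv (historyLaw A F f t) (historyLaw A F f' t) ≤ ENNReal.ofReal (1 / 2)) (i : Fin d)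
    (c c' : ℝ) :
    (c - c') ^ 2 / 8 ≤ coordError A F f t i c + 2 * coordError A F f' t i c' := by
  have := isProbabilityMeasure_historyLaw (A := A) F hf t
  have := isProbabilityMeasure_historyLaw (A := A) F hf' t
  let X : U × (Fin t → E d × ℝ) → ℝ := fun p => A.act t p.1 p.2 i
  have h_meas (b : ℝ) : Measurable fun p => dist (X p) b ^ 2 := by
    have := A.measurable_act t
    fun_prop
  have h_integrable {g : ℕ → E d → ℝ} (hg : ∀ t, Measurable (g t)) (b : ℝ) :
      Integrable (fun p => dist (X p) b ^ 2) (historyLaw A F g t) := by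
    refine (integrable_map_measure (h_meas b).aestronglyMeasurable
      (measurable_fst.prodMk (measurable_history hg t)).aemeasurable).2 ?_
    simp only [Function.comp_def, Real.dist_eq, sq_abs]
    exact integrable_sq_action_apply_sub F hg t i b
  have h_integral {g : ℕ → E d → ℝ} (hg : ∀ t, Measurable (g t)) (b : ℝ) :
      ∫ p, dist (X p) b ^ 2 ∂historyLaw A F g t = coordError A F g t i b := by
    rw [historyLaw, integral_map (measurable_fst.prodMk (measurable_history hg t)).aemeasurable
      (h_meas b).aestronglyMeasurable]
    simp only [Real.dist_eq, sq_abs]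
    rfl
  rw [← h_integral hf, ← h_integral hf', ← sq_abs (c - c'), ← Real.dist_eq]
  exact dist_sq_le_integral_add_integral_of_klDiv_le h (h_integrable hf c) (h_integrable hf' c')

lemma sum_coordError_le_integral_sub_sInf (hf : ∀ t, Continuous (f t)) {t : ℕ} {x : E d} {m : ℝ}
    (hx : x ∈ Ball d) (h_growth : ∀ z ∈ Ball d, f t x + m / 2 * ‖z - x‖ ^ 2 ≤ f t z) :
    m / 2 * ∑ i, coordError A F f t i (x i) ≤
      ∫ ω, (f t (action A f ω.1 ω.2 t) - sInf (f t '' Ball d)) ∂gameMeasure A F := by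
  have h_meas := fun s => (hf s).measurable
  have h_compact : IsCompact (f t '' Ball d) :=
    (isCompact_closedBall 0 1).image (hf t)
  have h_action (ω : U × (ℕ → ℝ)) : action A f ω.1 ω.2 t ∈ Ball d := A.act_mem _ _ _
  have h_int : Integrable (fun ω => f t (action A f ω.1 ω.2 t)) (gameMeasure A F) := by
    obtain ⟨C, hC⟩ := isBounded_iff_forall_norm_le.1 h_compact.isBounded
    exact .of_bound ((h_meas t).comp (measurable_action h_meas t)).aestronglyMeasurable C
      (ae_of_all _ fun ω => hC _ (Set.mem_image_of_mem _ (h_action ω)))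
  have h_sq (i : Fin d) := integrable_sq_action_apply_sub (A := A) F h_meas t i (x i)
  simp only [coordError]
  rw [← integral_finsetSum _ fun i _ => h_sq i, ← integral_const_mul]
  refine integral_mono ((integrable_finsetSum _ fun i _ => h_sq i).const_mul _)
    (h_int.sub (integrable_const _)) fun ω => ?_
  have h_min : sInf (f t '' Ball d) ≤ f t x :=
    csInf_le h_compact.bddBelow (Set.mem_image_of_mem _ hx)
  have h := h_growth _ (h_action ω)
  rw [EuclideanSpace.real_norm_sq_eq] at h
  simp only [PiLp.sub_apply] at h
  linarith

lemma KLCondition.klDiv_map_const_add_le {F : Measure ℝ} [IsProbabilityMeasure F] {I₀ : ℝ}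
    {v₀ : ℝ≥0∞} (hF : KLCondition F I₀ v₀) (hI₀ : 0 ≤ I₀) {w : ℝ} (hw : ENNReal.ofReal w < v₀)
    {x x' : ℝ} (hx : |x - x'| ≤ w) :
    klDiv (F.map fun y => x + y) (F.map fun y => x' + y) ≤ ENNReal.ofReal (I₀ * w ^ 2) := by
  have h_map : F.map (fun y => x' + y) =
      (F.map fun y => y - (x - x')).map fun y => x + y := by
    rw [Measure.map_map (by fun_prop) (by fun_prop)]
    congr 1 with y
    simp only [Function.comp_apply]
    ring
  have h_lt : ‖x - x'‖ₑ < v₀ := by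
    rw [Real.enorm_eq_ofReal_abs]
    exact (ENNReal.ofReal_le_ofReal hx).trans_lt hw
  have := Measure.isProbabilityMeasure_map (μ := F) (f := fun y => y - (x - x')) (by fun_prop)
  calc klDiv (F.map fun y => x + y) (F.map fun y => x' + y)
      ≤ klDiv F (F.map fun y => y - (x - x')) := by
        rw [h_map]
        exact klDiv_map_le _ _ (by fun_prop)
    _ ≤ ENNReal.ofReal (I₀ * (x - x') ^ 2) := hF _ h_lt
    _ ≤ ENNReal.ofReal (I₀ * w ^ 2) := by
        rw [← sq_abs (x - x')]
        gcongr

end Interaction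

/-! ### Quadratic losses perturbed by sine waves -/

section Losses

lemma add_mul_sub_add_sq_le_of_hasDerivAt {φ φ' : ℝ → ℝ} {α : ℝ}
    (hφ : ∀ x, HasDerivAt φ (φ' x) x) (hφ' : ∀ x y, x ≤ y → α * (y - x) ≤ φ' y - φ' x)
    (x y : ℝ) : φ x + φ' x * (y - x) + α / 2 * (y - x) ^ 2 ≤ φ y := by
  let g : ℝ → ℝ := fun x => φ x - α / 2 * x ^ 2
  have hg (x : ℝ) : HasDerivAt g (φ' x - α * x) x :=
    ((hφ x).sub (((hasDerivAt_id x).pow 2).const_mul (α / 2))).congr_deriv (by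
      simp only [id, Nat.cast_ofNat, mul_one]
      ring)
  have h_mono : Monotone (deriv g) := fun u v huv => by
    rw [(hg u).deriv, (hg v).deriv]
    linarith [hφ' u v huv]
  have h_convex : ConvexOn ℝ Set.univ g :=
    h_mono.convexOn_univ_of_deriv fun x => (hg x).differentiableAt
  have h_tangent : (φ' x - α * x) * (y - x) ≤ g y - g x := by
    rcases lt_trichotomy x y with h | rfl | h
    · have := h_convex.le_slope_of_hasDerivAt (Set.mem_univ x) (Set.mem_univ y) h (hg x)
      rwa [slope_def_field, le_div_iff₀ (sub_pos.2 h)] at this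
    · simp only [sub_self, mul_zero, le_refl]
    · have := h_convex.slope_le_of_hasDerivAt (Set.mem_univ y) (Set.mem_univ x) h (hg x)
      rw [slope_def_field, div_le_iff₀ (sub_pos.2 h)] at this
      linarith
  simp only [g] at h_tangent
  linarith

variable {d : ℕ}

/-- The function on `ℝᵈ` that adds up the profiles `φ i` of the coordinates and a constant. -/
def separable (c : ℝ) (φ : Fin d → ℝ → ℝ) (z : E d) : ℝ := c + ∑ i, φ i (z i)

section Separable

variable {c : ℝ} {φ φ' : Fin d → ℝ → ℝ}

lemma hasGradientAt_separable (hφ : ∀ i x, HasDerivAt (φ i) (φ' i x) x) (z : E d) :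
    HasGradientAt (separable c φ) (WithLp.toLp 2 fun i => φ' i (z i)) z := by
  have h_sum := (HasFDerivAt.fun_sum (u := Finset.univ) fun i _ =>
    (hφ i (z i)).comp_hasFDerivAt z
      (EuclideanSpace.proj i : E d →L[ℝ] ℝ).hasFDerivAt).const_add c
  refine hasGradientAt_iff_hasFDerivAt.2 (h_sum.congr_fderiv ?_)
  ext v
  simp [PiLp.inner_apply, mul_comm]

lemma stronglyConvex_separable {α : ℝ} (hφ : ∀ i x, HasDerivAt (φ i) (φ' i x) x)
    (hφ' : ∀ i x y, x ≤ y → α * (y - x) ≤ φ' i y - φ' i x) :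
    StronglyConvex α (separable c φ) := by
  refine ⟨fun z => (hasGradientAt_separable hφ z).differentiableAt, fun x z => ?_⟩
  rw [(hasGradientAt_separable hφ x).gradient, PiLp.inner_apply, EuclideanSpace.real_norm_sq_eq,
    Finset.mul_sum, separable, separable, add_assoc, add_assoc, ← Finset.sum_add_distrib,
    ← Finset.sum_add_distrib]
  gcongr with i
  have h := add_mul_sub_add_sq_le_of_hasDerivAt (hφ i) (hφ' i) (x i) (z i)
  simp only [PiLp.sub_apply, RCLike.inner_apply, conj_trivial]
  linarith

lemma smooth_separable {β : ℝ} (hβ : 0 ≤ β) (hφ : ∀ i x, HasDerivAt (φ i) (φ' i x) x)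
    (hφ' : ∀ i x y, |φ' i x - φ' i y| ≤ β * |x - y|) : Smooth β (separable c φ) := by
  have h_contDiff (i : Fin d) : ContDiff ℝ 1 (φ i) := by
    rw [contDiff_one_iff_deriv, show deriv (φ i) = φ' i from funext fun x => (hφ i x).deriv]
    refine ⟨fun x => (hφ i x).differentiableAt, LipschitzWith.continuous (K := β.toNNReal) ?_⟩
    refine LipschitzWith.of_dist_le_mul fun x y => ?_
    rw [Real.coe_toNNReal β hβ]
    exact hφ' i x y
  refine ⟨contDiff_const.add (ContDiff.sum fun i _ =>
    (h_contDiff i).comp (EuclideanSpace.proj i : E d →L[ℝ] ℝ).contDiff), fun x z => ?_⟩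
  rw [(hasGradientAt_separable hφ x).gradient, (hasGradientAt_separable hφ z).gradient]
  refine (sq_le_sq₀ (norm_nonneg _) (by positivity)).1 ?_
  rw [mul_pow, EuclideanSpace.real_norm_sq_eq, EuclideanSpace.real_norm_sq_eq, Finset.mul_sum]
  gcongr with i
  rw [← mul_pow, sq_le_sq, abs_mul, abs_of_nonneg hβ]
  exact hφ' i (x i) (z i)

end Separable

/-- A parabola of curvature `a` minus a sine wave. The normalization `κ μ²` makes the second
derivative of the wave of size `κ`, whatever the wavelength `μ`. -/
noncomputable def waveProfile (a κ μ s x : ℝ) : ℝ :=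
  a / 2 * x ^ 2 - κ * μ ^ 2 * (s * Real.sin (x / μ))

/-- The derivative of `waveProfile`. -/
noncomputable def waveSlope (a κ μ s x : ℝ) : ℝ := a * x - κ * μ * (s * Real.cos (x / μ))

/-- The loss with profile `waveProfile a κ μ (s i)` in the `i`-th coordinate. The constant centers
the values of the quadratic part on the ball around `0`. -/
noncomputable def waveLoss (a κ μ : ℝ) (s : Fin d → ℝ) : E d → ℝ :=
  separable (-(a / 4)) fun i => waveProfile a κ μ (s i)

/-- The minimizer of `waveLoss a κ μ s` when `a y = κ cos y` and the entries of `s` are signs. -/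
noncomputable def waveMinimizer (y μ : ℝ) (s : Fin d → ℝ) : E d :=
  WithLp.toLp 2 fun i => s i * (y * μ)

variable {a κ μ y α β B : ℝ} {s s' : Fin d → ℝ}

lemma hasDerivAt_waveProfile (s x : ℝ) :
    HasDerivAt (waveProfile a κ μ s) (waveSlope a κ μ s x) x := by
  have h_sq := ((hasDerivAt_id x).pow 2).const_mul (a / 2)
  have h_sin := ((((hasDerivAt_id x).div_const μ).sin).const_mul s).const_mul (κ * μ ^ 2)
  refine (h_sq.sub h_sin).congr_deriv ?_
  simp only [id, waveSlope]
  field_simp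
  push_cast
  ring

lemma abs_waveSlope_sub_le (hκ : 0 ≤ κ) (hμ : 0 < μ) {s : ℝ} (hs : |s| ≤ 1) (x y : ℝ) :
    |waveSlope a κ μ s y - waveSlope a κ μ s x - a * (y - x)| ≤ κ * |y - x| := by
  have h_cos := Real.abs_cos_sub_cos_le (y / μ) (x / μ)
  rw [← sub_div, abs_div, abs_of_pos hμ, le_div_iff₀ hμ] at h_cos
  calc |waveSlope a κ μ s y - waveSlope a κ μ s x - a * (y - x)|
      = |(κ * μ * s) * (Real.cos (y / μ) - Real.cos (x / μ))| := by
        rw [← abs_neg]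
        simp only [waveSlope]
        ring_nf
    _ = |s| * (κ * (|Real.cos (y / μ) - Real.cos (x / μ)| * μ)) := by
        rw [abs_mul, abs_mul, abs_of_nonneg (mul_nonneg hκ hμ.le)]
        ring
    _ ≤ 1 * (κ * |y - x|) := by gcongr
    _ = κ * |y - x| := one_mul _

lemma stronglyConvex_waveLoss (hκ : 0 ≤ κ) (hμ : 0 < μ) (hα : α ≤ a - κ) (hs : ∀ i, |s i| ≤ 1) :
    StronglyConvex α (waveLoss a κ μ s) := by
  refine stronglyConvex_separable (fun i => hasDerivAt_waveProfile (s i))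
    fun i x y hxy => ?_
  have h := (abs_le.1 (abs_waveSlope_sub_le (a := a) hκ hμ (hs i) x y)).1
  rw [abs_of_nonneg (sub_nonneg.2 hxy)] at h
  nlinarith

lemma smooth_waveLoss (ha : 0 ≤ a) (hκ : 0 ≤ κ) (hμ : 0 < μ) (hβ : a + κ ≤ β)
    (hs : ∀ i, |s i| ≤ 1) : Smooth β (waveLoss a κ μ s) := by
  refine smooth_separable ((add_nonneg ha hκ).trans hβ)
    (fun i => hasDerivAt_waveProfile (s i)) fun i x y => ?_
  calc |waveSlope a κ μ (s i) x - waveSlope a κ μ (s i) y|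
      ≤ κ * |x - y| + |a * (x - y)| := by
        linarith [abs_sub_abs_le_abs_sub (waveSlope a κ μ (s i) x - waveSlope a κ μ (s i) y)
          (a * (x - y)), abs_waveSlope_sub_le (a := a) hκ hμ (hs i) y x]
    _ = (a + κ) * |x - y| := by
        rw [abs_mul, abs_of_nonneg ha]
        ring
    _ ≤ β * |x - y| := by gcongr

lemma continuous_waveLoss : Continuous (waveLoss a κ μ s) := by
  unfold waveLoss separable waveProfile
  fun_prop

lemma abs_waveLoss_sub_waveLoss_le (hκ : 0 ≤ κ) (s s' : Fin d → ℝ) (z : E d) :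
    |waveLoss a κ μ s z - waveLoss a κ μ s' z| ≤ κ * μ ^ 2 * ∑ i, |s i - s' i| := by
  have h_sub : waveLoss a κ μ s z - waveLoss a κ μ s' z =
      κ * μ ^ 2 * ∑ i, (s' i - s i) * Real.sin (z i / μ) := by
    simp only [waveLoss, separable, waveProfile, add_sub_add_left_eq_sub,
      ← Finset.sum_sub_distrib, Finset.mul_sum]
    exact Finset.sum_congr rfl fun i _ => by ring
  rw [h_sub, abs_mul, abs_of_nonneg (by positivity)]
  gcongr
  refine (Finset.abs_sum_le_sum_abs _ _).trans (Finset.sum_le_sum fun i _ => ?_)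
  rw [abs_mul, abs_sub_comm]
  exact mul_le_of_le_one_right (abs_nonneg _) (Real.abs_sin_le_one _)

lemma abs_waveLoss_le (ha : 0 ≤ a) (hκ : 0 ≤ κ) (hs : ∀ i, |s i| ≤ 1) {z : E d}
    (hz : z ∈ Ball d) : |waveLoss a κ μ s z| ≤ a / 4 + κ * (d * μ ^ 2) := by
  have h_quadratic : waveLoss a κ μ 0 z = a / 2 * ‖z‖ ^ 2 - a / 4 := by
    simp only [waveLoss, separable, waveProfile, Pi.zero_apply, zero_mul, mul_zero, sub_zero,
      EuclideanSpace.real_norm_sq_eq, Finset.mul_sum]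
    ring
  have h_norm : ‖z‖ ^ 2 ≤ 1 := pow_le_one₀ (norm_nonneg _) (mem_closedBall_zero_iff.1 hz)
  have h_center : |waveLoss a κ μ 0 z| ≤ a / 4 := by
    rw [h_quadratic, abs_le]
    constructor <;> nlinarith [sq_nonneg ‖z‖]
  have h_wave : |waveLoss a κ μ s z - waveLoss a κ μ 0 z| ≤ κ * (d * μ ^ 2) :=
    calc _ ≤ κ * μ ^ 2 * ∑ i, |s i - 0| := abs_waveLoss_sub_waveLoss_le hκ s 0 z
      _ ≤ κ * μ ^ 2 * ∑ _i : Fin d, 1 := by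
        gcongr with i
        simpa only [sub_zero] using hs i
      _ = κ * (d * μ ^ 2) := by
        rw [Finset.sum_const, Finset.card_univ, Fintype.card_fin, nsmul_one]
        ring
  linarith [abs_sub_abs_le_abs_sub (waveLoss a κ μ s z) (waveLoss a κ μ 0 z)]

lemma waveSlope_eq_zero (hμ : μ ≠ 0) (hy : a * y = κ * Real.cos y) {s : ℝ} (hs : |s| = 1) :
    waveSlope a κ μ s (s * (y * μ)) = 0 := by
  have h_cos : Real.cos (s * (y * μ) / μ) = Real.cos y := by
    rcases eq_or_eq_neg_of_abs_eq hs with rfl | rfl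
    · rw [one_mul, mul_div_cancel_right₀ _ hμ]
    · rw [neg_one_mul, neg_div, mul_div_cancel_right₀ _ hμ, Real.cos_neg]
  rw [waveSlope, h_cos]
  linear_combination s * μ * hy

lemma waveLoss_waveMinimizer_add_le (hκ : 0 ≤ κ) (hμ : 0 < μ) (hy : a * y = κ * Real.cos y)
    (hα : α ≤ a - κ) (hs : ∀ i, |s i| = 1) (z : E d) :
    waveLoss a κ μ s (waveMinimizer y μ s) + α / 2 * ‖z - waveMinimizer y μ s‖ ^ 2 ≤
      waveLoss a κ μ s z := by
  have h_gradient : ∇ (waveLoss a κ μ s) (waveMinimizer y μ s) = 0 := by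
    rw [waveLoss, (hasGradientAt_separable
      (fun i => hasDerivAt_waveProfile (s i)) (waveMinimizer y μ s)).gradient]
    ext i
    exact waveSlope_eq_zero hμ.ne' hy (hs i)
  have h := (stronglyConvex_waveLoss hκ hμ hα fun i => (hs i).le).2 (waveMinimizer y μ s) z
  rwa [h_gradient, inner_zero_left, add_zero] at h

/-- The curvatures `a` and amplitudes `κ` for which all wave losses with `d μ² ≤ 1` belong to the
class `IsLoss α β B`; `y` is the position of the minimizers in units of the wavelength. -/
structure IsAdmissible (α β B a κ y : ℝ) : Prop where
  amplitude_nonneg : 0 ≤ κ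
  shift_pos : 0 < y
  shift_le_one : y ≤ 1
  critical : a * y = κ * Real.cos y
  le_sub : α ≤ a - κ
  add_le : a + κ ≤ β
  bound : a / 4 + κ ≤ B

lemma IsAdmissible.waveMinimizer_mem_ball (h : IsAdmissible α β B a κ y) (hdμ : d * μ ^ 2 ≤ 1)
    (hs : ∀ i, |s i| = 1) : waveMinimizer y μ s ∈ Ball d := by
  refine mem_closedBall_zero_iff.2 ((sq_le_one_iff₀ (norm_nonneg _)).1 ?_)
  calc ‖waveMinimizer y μ s‖ ^ 2 = ∑ i, |s i| ^ 2 * (y * μ) ^ 2 := by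
        simp only [EuclideanSpace.real_norm_sq_eq, waveMinimizer, mul_pow, sq_abs]
    _ = y ^ 2 * (d * μ ^ 2) := by
        simp only [hs, one_pow, one_mul, Finset.sum_const, Finset.card_univ, Fintype.card_fin,
          nsmul_eq_mul]
        ring
    _ ≤ 1 := mul_le_one₀ (pow_le_one₀ h.shift_pos.le h.shift_le_one) (by positivity) hdμ

lemma IsAdmissible.isLoss_waveLoss (h : IsAdmissible α β B a κ y) (hα : 0 ≤ α) (hμ : 0 < μ)
    (hdμ : d * μ ^ 2 ≤ 1) (hs : ∀ i, |s i| = 1) : IsLoss α β B (waveLoss a κ μ s) := by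
  have hs' (i : Fin d) : |s i| ≤ 1 := (hs i).le
  have ha : 0 ≤ a := by linarith [h.le_sub, h.amplitude_nonneg]
  refine ⟨stronglyConvex_waveLoss h.amplitude_nonneg hμ h.le_sub hs',
    smooth_waveLoss ha h.amplitude_nonneg hμ h.add_le hs', fun z hz => ?_,
    waveMinimizer y μ s, h.waveMinimizer_mem_ball hdμ hs, fun z => ?_⟩
  · have := mul_le_of_le_one_right h.amplitude_nonneg hdμ
    linarith [abs_waveLoss_le (μ := μ) ha h.amplitude_nonneg hs' hz, h.bound]
  · have := waveLoss_waveMinimizer_add_le h.amplitude_nonneg hμ h.critical h.le_sub hs z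
    exact (le_add_of_nonneg_right (by positivity)).trans this

lemma exists_isAdmissible (hα : 0 < α) (hαβ : α < β) (hB : α / 4 < B) :
    ∃ a κ y, IsAdmissible α β B a κ y := by
  obtain ⟨a, hαa, ha⟩ := exists_between (lt_min hαβ (show α < 4 * B by linarith))
  obtain ⟨haβ, haB⟩ := lt_min_iff.1 ha
  obtain ⟨κ₀, hκ₀, hκ₀_lt⟩ := exists_between
    (lt_min (lt_min (sub_pos.2 hαa) (sub_pos.2 haβ)) (show 0 < B - a / 4 by linarith))
  obtain ⟨⟨hκα, hκβ⟩, hκB⟩ := (lt_min_iff.1 hκ₀_lt).imp_left lt_min_iff.1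
  have ha_pos : 0 < a := hα.trans hαa
  let y := min 1 (κ₀ / (2 * a))
  have hy_pos : 0 < y := lt_min one_pos (by positivity)
  have hy_le : y ≤ 1 := min_le_left _ _
  have hyκ : y * (2 * a) ≤ κ₀ := (le_div_iff₀ (by positivity)).1 (min_le_right _ _)
  have h_cos : 1 / 2 ≤ Real.cos y := by
    nlinarith [Real.one_sub_sq_div_two_le_cos (x := y)]
  have h_cos_pos : 0 < Real.cos y := by linarith
  have hκ : a * y / Real.cos y ≤ κ₀ := by
    rw [div_le_iff₀ h_cos_pos]
    nlinarith
  exact ⟨a, a * y / Real.cos y, y, by positivity, hy_pos, hy_le,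
    (div_mul_cancel₀ _ h_cos_pos.ne').symm, by linarith, by linarith, by linarith⟩

end Losses

/-! ### Random signs on blocks of rounds -/

section RandomSigns

lemma card_mul_le_sum_of_involutive {ι : Type*} [Fintype ι] {g : ι → ι} (hg : g.Involutive)
    {e : ι → ℝ} {k m : ℝ} (h : ∀ x, m ≤ e x + k * e (g x)) :
    Fintype.card ι * m ≤ (1 + k) * ∑ x, e x :=
  calc Fintype.card ι * m = ∑ _x : ι, m := by
        rw [Finset.sum_const, Finset.card_univ, nsmul_eq_mul]
    _ ≤ ∑ x, (e x + k * e (g x)) := Finset.sum_le_sum fun x _ => h x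
    _ = (1 + k) * ∑ x, e x := by
        rw [Finset.sum_add_distrib, ← Finset.mul_sum,
          show ∑ x, e (g x) = ∑ x, e x from Equiv.sum_comp hg.toPerm e]
        ring

lemma abs_intCast_units (u : ℤˣ) : |((u : ℤ) : ℝ)| = 1 := by
  rw [← Int.cast_abs, Int.isUnit_iff_abs_eq.1 u.isUnit, Int.cast_one]

/-- Reverses the sign with index `p`. -/
def flipSign {ι : Type*} [DecidableEq ι] (p : ι) (σ : ι → ℤˣ) : ι → ℤˣ :=
  Function.update σ p (-σ p)

lemma flipSign_involutive {ι : Type*} [DecidableEq ι] (p : ι) :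
    Function.Involutive (flipSign p) := fun σ => by
  simp only [flipSign, Function.update_self, Function.update_idem, neg_neg,
    Function.update_eq_self]

variable {d : ℕ} {J : Type*}

/-- The environment whose rounds are divided into blocks: the loss of round `t` is the wave loss
with the signs `σ (b t, ·)` of the block `b t`. -/
noncomputable def blockEnv (a κ μ : ℝ) (b : ℕ → J) (σ : J × Fin d → ℤˣ) (t : ℕ) : E d → ℝ :=
  waveLoss a κ μ fun i => ((σ (b t, i) : ℤ) : ℝ)

variable {U : Type*} [MeasurableSpace U] {α β B a κ y μ I₀ Δ : ℝ} {v₀ : ℝ≥0∞} {T S : ℕ}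
  {F : Measure ℝ} [IsProbabilityMeasure F] {b : ℕ → J}

lemma measurable_blockEnv (σ : J × Fin d → ℤˣ) (t : ℕ) : Measurable (blockEnv a κ μ b σ t) :=
  continuous_waveLoss.measurable

lemma abs_blockEnv_sub_le (hκ : 0 ≤ κ) (σ : J × Fin d → ℤˣ) (t t' : ℕ) (z : E d) :
    |blockEnv a κ μ b σ t z - blockEnv a κ μ b σ t' z| ≤ 2 * κ * (d * μ ^ 2) :=
  calc _ ≤ κ * μ ^ 2 * ∑ i, |((σ (b t, i) : ℤ) : ℝ) - ((σ (b t', i) : ℤ) : ℝ)| :=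
        abs_waveLoss_sub_waveLoss_le hκ _ _ z
    _ ≤ κ * μ ^ 2 * ∑ _i : Fin d, (1 + 1) := by
        gcongr with i
        exact (abs_sub _ _).trans_eq (by rw [abs_intCast_units, abs_intCast_units])
    _ = 2 * κ * (d * μ ^ 2) := by
        rw [Finset.sum_const, Finset.card_univ, Fintype.card_fin, nsmul_eq_mul]
        ring

section Flip

variable [DecidableEq J]

lemma blockEnv_flipSign_of_ne {s t : ℕ} (h : b s ≠ b t) (σ : J × Fin d → ℤˣ) (i : Fin d) :
    blockEnv a κ μ b (flipSign (b t, i) σ) s = blockEnv a κ μ b σ s := by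
  have h_sign (j : Fin d) : flipSign (b t, i) σ (b s, j) = σ (b s, j) :=
    Function.update_of_ne (fun hp => h (congrArg Prod.fst hp)) _ _
  simp only [blockEnv, h_sign]

lemma abs_blockEnv_sub_flipSign_le (hκ : 0 ≤ κ) (p : J × Fin d) (σ : J × Fin d → ℤˣ) (t : ℕ)
    (z : E d) : |blockEnv a κ μ b σ t z - blockEnv a κ μ b (flipSign p σ) t z| ≤ 2 * κ * μ ^ 2 := by
  have h_ne (i : Fin d) (hi : i ≠ p.2) :
      |((σ (b t, i) : ℤ) : ℝ) - ((flipSign p σ (b t, i) : ℤ) : ℝ)| = 0 := by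
    rw [flipSign, Function.update_of_ne fun hp => hi (congrArg Prod.snd hp), sub_self, abs_zero]
  have h_flip : |((σ (b t, p.2) : ℤ) : ℝ) - ((flipSign p σ (b t, p.2) : ℤ) : ℝ)| ≤ 2 :=
    (abs_sub _ _).trans (by simp only [abs_intCast_units]; norm_num)
  calc _ ≤ κ * μ ^ 2 * ∑ i, |((σ (b t, i) : ℤ) : ℝ) - ((flipSign p σ (b t, i) : ℤ) : ℝ)| :=
        abs_waveLoss_sub_waveLoss_le hκ _ _ z
    _ ≤ κ * μ ^ 2 * 2 := by
        rw [Fintype.sum_eq_single p.2 h_ne]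
        gcongr
    _ = 2 * κ * μ ^ 2 := by ring

lemma klDiv_historyLaw_flipSign_le (hF : KLCondition F I₀ v₀) (hI₀ : 0 ≤ I₀) (hκ : 0 ≤ κ)
    (hw : ENNReal.ofReal (2 * κ * μ ^ 2) < v₀) (A : RandomizedAlgorithm d U) (t : ℕ) (i : Fin d)
    (σ : J × Fin d → ℤˣ) :
    klDiv (historyLaw A F (blockEnv a κ μ b σ) t)
      (historyLaw A F (blockEnv a κ μ b (flipSign (b t, i) σ)) t) ≤
      ENNReal.ofReal
        (((Finset.range t).filter fun s => b s = b t).card * (I₀ * (2 * κ * μ ^ 2) ^ 2)) := by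
  refine (klDiv_historyLaw_le F (measurable_blockEnv _) (measurable_blockEnv _)
    (fun s => if b s = b t then ENNReal.ofReal (I₀ * (2 * κ * μ ^ 2) ^ 2) else 0) t
    fun s _ z _ => ?_).trans_eq ?_
  · split_ifs with hs
    · exact hF.klDiv_map_const_add_le hI₀ hw (abs_blockEnv_sub_flipSign_le hκ _ _ _ _)
    · have := Measure.isProbabilityMeasure_map (μ := F)
        (f := fun x => blockEnv a κ μ b σ s z + x) (by fun_prop)
      rw [blockEnv_flipSign_of_ne hs, klDiv_self]
  · rw [← Finset.sum_filter, Finset.sum_const, nsmul_eq_mul,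
      ENNReal.ofReal_mul (Nat.cast_nonneg _), ENNReal.ofReal_natCast]

lemma sq_le_coordError_add_coordError_flipSign (hF : KLCondition F I₀ v₀) (hI₀ : 0 ≤ I₀)
    (hκ : 0 ≤ κ) (hw : ENNReal.ofReal (2 * κ * μ ^ 2) < v₀) (A : RandomizedAlgorithm d U) {t : ℕ}
    (hb : ((Finset.range t).filter fun s => b s = b t).card * (I₀ * (2 * κ * μ ^ 2) ^ 2) ≤ 1 / 2)
    (y : ℝ) (i : Fin d) (σ : J × Fin d → ℤˣ) :
    (y * μ) ^ 2 / 2 ≤ coordError A F (blockEnv a κ μ b σ) t i ((σ (b t, i) : ℤ) * (y * μ)) +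
      2 * coordError A F (blockEnv a κ μ b (flipSign (b t, i) σ)) t i
        ((flipSign (b t, i) σ (b t, i) : ℤ) * (y * μ)) := by
  have h_klDiv := (klDiv_historyLaw_flipSign_le (a := a) hF hI₀ hκ hw A t i σ).trans
    (ENNReal.ofReal_le_ofReal hb)
  have h_flip : ((flipSign (b t, i) σ (b t, i) : ℤ) : ℝ) = -((σ (b t, i) : ℤ) : ℝ) := by
    rw [flipSign, Function.update_self, Units.val_neg, Int.cast_neg]
  have h_sq : ((σ (b t, i) : ℤ) : ℝ) ^ 2 = 1 := by
    rw [← sq_abs, abs_intCast_units, one_pow]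
  refine le_trans (le_of_eq ?_) (sq_sub_le_coordError_add_coordError F (measurable_blockEnv _)
    (measurable_blockEnv _) h_klDiv i _ _)
  rw [h_flip]
  linear_combination -((y * μ) ^ 2 / 2) * h_sq

end Flip

lemma IsAdmissible.sum_coordError_le_regret (h : IsAdmissible α β B a κ y) (hμ : 0 < μ)
    (hdμ : d * μ ^ 2 ≤ 1) (A : RandomizedAlgorithm d U) (σ : J × Fin d → ℤˣ) :
    ∑ t ∈ Finset.range T, α / 2 * ∑ i,
        coordError A F (blockEnv a κ μ b σ) t i ((σ (b t, i) : ℤ) * (y * μ)) ≤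
      regret A F T (blockEnv a κ μ b σ) :=
  Finset.sum_le_sum fun t _ => sum_coordError_le_integral_sub_sInf F
    (x := waveMinimizer y μ fun i => ((σ (b t, i) : ℤ) : ℝ)) (fun _ => continuous_waveLoss)
    (h.waveMinimizer_mem_ball hdμ fun _ => abs_intCast_units _)
    fun z _ => waveLoss_waveMinimizer_add_le h.amplitude_nonneg hμ h.critical h.le_sub
      (fun _ => abs_intCast_units _) z

lemma IsAdmissible.exists_le_regret_blockEnv [Finite J] [DecidableEq J]
    (h : IsAdmissible α β B a κ y) (hα : 0 ≤ α) (hμ : 0 < μ) (hdμ : d * μ ^ 2 ≤ 1)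
    (hF : KLCondition F I₀ v₀) (hI₀ : 0 ≤ I₀) (hw : ENNReal.ofReal (2 * κ * μ ^ 2) < v₀)
    (hb : ∀ t < T, ((Finset.range t).filter fun s => b s = b t).card *
      (I₀ * (2 * κ * μ ^ 2) ^ 2) ≤ 1 / 2) (A : RandomizedAlgorithm d U) :
    ∃ σ : J × Fin d → ℤˣ,
      T * (α * y ^ 2 / 12 * (d * μ ^ 2)) ≤ regret A F T (blockEnv a κ μ b σ) := by
  have := Fintype.ofFinite J
  let e (σ : J × Fin d → ℤˣ) (t : ℕ) (i : Fin d) : ℝ :=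
    coordError A F (blockEnv a κ μ b σ) t i ((σ (b t, i) : ℤ) * (y * μ))
  have h_error (t : ℕ) (ht : t < T) (i : Fin d) :
      Fintype.card (J × Fin d → ℤˣ) * ((y * μ) ^ 2 / 6) ≤ ∑ σ, e σ t i := by
    have := card_mul_le_sum_of_involutive (flipSign_involutive (b t, i)) (e := fun σ => e σ t i)
      (sq_le_coordError_add_coordError_flipSign hF hI₀ h.amplitude_nonneg hw A (hb t ht) y i)
    linarith
  have h_average : ∑ _σ : J × Fin d → ℤˣ, T * (α * y ^ 2 / 12 * (d * μ ^ 2)) ≤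
      ∑ σ, regret A F T (blockEnv a κ μ b σ) :=
    calc _ = ∑ _t ∈ Finset.range T, α / 2 * ∑ _i : Fin d,
          Fintype.card (J × Fin d → ℤˣ) * ((y * μ) ^ 2 / 6) := by
          simp only [Finset.sum_const, nsmul_eq_mul, Finset.card_univ, Finset.card_range,
            Fintype.card_fin]
          ring
      _ ≤ ∑ t ∈ Finset.range T, α / 2 * ∑ i, ∑ σ, e σ t i := by
          gcongr with t ht i
          exact h_error t (Finset.mem_range.1 ht) i
      _ = ∑ σ, ∑ t ∈ Finset.range T, α / 2 * ∑ i, e σ t i := by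
          rw [Finset.sum_comm]
          refine Finset.sum_congr rfl fun t _ => ?_
          rw [Finset.sum_comm, Finset.mul_sum]
      _ ≤ _ := Finset.sum_le_sum fun σ _ => h.sum_coordError_le_regret hμ hdμ A σ
  obtain ⟨σ, -, hσ⟩ := Finset.exists_le_of_sum_le Finset.univ_nonempty h_average
  exact ⟨σ, hσ⟩

lemma IsAdmissible.isEnvironment_blockEnv [DecidableEq J] (h : IsAdmissible α β B a κ y)
    (hα : 0 ≤ α) (hμ : 0 < μ) (hdμ : d * μ ^ 2 ≤ 1)
    (hS : 1 + ((Finset.range (T - 1)).filter fun t => b t ≠ b (t + 1)).card ≤ S)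
    (hΔ : ((Finset.range (T - 1)).filter fun t => b t ≠ b (t + 1)).card *
      (2 * κ * (d * μ ^ 2)) ≤ Δ) (σ : J × Fin d → ℤˣ) :
    IsEnvironment α β B T S Δ (blockEnv a κ μ b σ) := by
  have h_isLoss (t : ℕ) : IsLoss α β B (blockEnv a κ μ b σ t) :=
    h.isLoss_waveLoss hα hμ hdμ fun _ => abs_intCast_units _
  have h_eq {t : ℕ} (ht : b t = b (t + 1)) :
      blockEnv a κ μ b σ (t + 1) = blockEnv a κ μ b σ t := by
    simp only [blockEnv, ht]
  refine ⟨fun t _ => h_isLoss t, le_trans ?_ hΔ, le_trans ?_ hS⟩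
  · rw [totalVariation, ← nsmul_eq_mul, ← Finset.sum_const, Finset.sum_filter]
    refine Finset.sum_le_sum fun t _ => Real.sSup_le ?_ ?_
    · rintro _ ⟨z, -, rfl⟩
      split_ifs with ht
      · exact abs_blockEnv_sub_le h.amplitude_nonneg σ _ _ z
      · simp only [h_eq (not_not.1 ht), sub_self, abs_zero, le_refl]
    · have := h.amplitude_nonneg
      split_ifs <;> positivity
  · rw [numSwitches, Finset.card_filter]
    gcongr with t
    split_ifs with h_meet ht ht
    · exact zero_le_one
    · exact le_rfl
    · exact le_rfl
    · obtain ⟨x, hx, hx_min⟩ := (h_isLoss t).minimizer_mem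
      rw [h_eq (not_not.1 ht), Set.inter_self] at h_meet
      exact absurd ⟨x, hx, fun z _ => hx_min z⟩ h_meet

lemma exists_block_partition (T : ℕ) {n : ℕ} (hn : 0 < n) : ∃ b : ℕ → Fin (T + 1),
    (∀ t < T, ((Finset.range t).filter fun s => b s = b t).card ≤ n) ∧
      ((Finset.range (T - 1)).filter fun t => b t ≠ b (t + 1)).card ≤ (T - 1) / n := by
  refine ⟨fun t => ⟨min (t / n) T, by omega⟩, fun t ht => ?_, ?_⟩
  · refine (Finset.card_le_card (t := Finset.Ico (n * (t / n)) (n * (t / n) + n))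
      fun s hs => ?_).trans_eq (by rw [Nat.card_Ico, Nat.add_sub_cancel_left])
    simp only [Finset.mem_filter, Finset.mem_range, Fin.mk.injEq] at hs
    have h_div : s / n = t / n := by
      have := Nat.div_le_self s n
      have := Nat.div_le_self t n
      omega
    rw [← h_div, Finset.mem_Ico]
    exact ⟨Nat.mul_div_le s n, Nat.lt_mul_div_succ s hn⟩
  · rw [← Nat.card_multiples (T - 1) n]
    gcongr with t
    simp only [ne_eq, Fin.mk.injEq]
    intro h
    by_contra h_dvd
    rw [Nat.succ_div, if_neg h_dvd, add_zero] at h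
    exact h rfl

end RandomSigns

/-! ### Choice of the wavelength and of the block length -/

section Parameters

lemma exists_scale (κ I₀ : ℝ) {v₀ : ℝ≥0∞} (hv₀ : 0 < v₀) :
    ∃ θ : ℝ, 0 < θ ∧ θ ≤ 1 ∧ 2 * κ * θ ≤ 1 ∧ ENNReal.ofReal (2 * κ * θ) < v₀ ∧
      I₀ * (2 * κ * θ) ^ 2 ≤ 1 / 2 := by
  have h_lin : Filter.Tendsto (fun θ : ℝ => 2 * κ * θ) (nhds 0) (nhds 0) :=
    Continuous.tendsto' (by fun_prop) 0 0 (mul_zero _)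
  have h_sq : Filter.Tendsto (fun θ : ℝ => I₀ * (2 * κ * θ) ^ 2) (nhds 0) (nhds 0) :=
    Continuous.tendsto' (by fun_prop) 0 0 (by ring)
  have h_ofReal : Filter.Tendsto (fun θ : ℝ => ENNReal.ofReal (2 * κ * θ)) (nhds 0) (nhds 0) :=
    ENNReal.ofReal_zero ▸ ENNReal.tendsto_ofReal h_lin
  have h_near : ∀ᶠ θ : ℝ in nhds 0, θ ≤ 1 ∧ 2 * κ * θ ≤ 1 ∧ ENNReal.ofReal (2 * κ * θ) < v₀ ∧
      I₀ * (2 * κ * θ) ^ 2 ≤ 1 / 2 := by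
    filter_upwards [eventually_le_nhds one_pos, h_lin.eventually_le_const one_pos,
      h_ofReal.eventually_lt_const hv₀, h_sq.eventually_le_const one_half_pos] with θ h₁ h₂ h₃ h₄
    exact ⟨h₁, h₂, h₃, h₄⟩
  exact ((eventually_mem_nhdsWithin (s := Set.Ioi 0)).and
    (h_near.filter_mono nhdsWithin_le_nhds)).exists

lemma exists_wavelength {d n : ℕ} (hd : 0 < d) (hn : 0 < n) {θ : ℝ} (hθ : 0 < θ) :
    ∃ μ : ℝ, 0 < μ ∧ d * μ ^ 2 = θ * min 1 (d / √n) ∧ μ ^ 2 ≤ θ ∧ μ ^ 2 * √n ≤ θ := by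
  have hd' : (0 : ℝ) < d := Nat.cast_pos.2 hd
  have hn' : 0 < √(n : ℝ) := Real.sqrt_pos.2 (Nat.cast_pos.2 hn)
  set q : ℝ := min 1 (d / √n)
  have : 0 < q := lt_min one_pos (by positivity)
  have h_sq : √(θ * q / d) ^ 2 = θ * q / d := Real.sq_sqrt (by positivity)
  refine ⟨√(θ * q / d), Real.sqrt_pos.2 (by positivity), ?_, ?_, ?_⟩
  · rw [h_sq, mul_div_cancel₀ _ hd'.ne']
  · rw [h_sq, div_le_iff₀ hd']
    exact mul_le_mul_of_nonneg_left ((min_le_left _ _).trans (Nat.one_le_cast.2 hd)) hθ.le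
  · rw [h_sq, div_mul_eq_mul_div, div_le_iff₀ hd', mul_assoc]
    gcongr
    exact (le_div_iff₀ hn').1 (min_le_right _ _)

variable {α β B I₀ : ℝ} {v₀ : ℝ≥0∞}

lemma exists_le_dynRegret_of_blockLength.{u} (hα : 0 < α) (hαβ : α < β) (hB : α / 4 < B)
    (hI₀ : 0 ≤ I₀) (hv₀ : 0 < v₀) :
    ∃ c : ℝ, 0 < c ∧ ∀ (F : Measure ℝ) [IsProbabilityMeasure F], KLCondition F I₀ v₀ →
      ∀ (d T S n : ℕ) (Δ : ℝ), 0 < d → 0 < n → 1 + (T - 1) / n ≤ S →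
        ((T - 1) / n : ℕ) * (d / √n) ≤ Δ →
      ∀ (U : Type u) [MeasurableSpace U] (A : RandomizedAlgorithm d U),
        ((c * (T * min 1 (d / √n)) : ℝ) : EReal) ≤ dynRegret A F α β B T S Δ := by
  obtain ⟨a, κ, y, h⟩ := exists_isAdmissible hα hαβ hB
  obtain ⟨θ, hθ, hθ_le, hκθ, hv, hI⟩ := exists_scale κ I₀ hv₀
  have hy := h.shift_pos
  have hκ := h.amplitude_nonneg
  refine ⟨α * y ^ 2 / 12 * θ, by positivity, fun F _ hF d T S n Δ hd hn hS hΔ U _ A => ?_⟩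
  obtain ⟨μ, hμ, hdμ, hμθ, hμn⟩ := exists_wavelength hd hn hθ
  obtain ⟨b, h_size, h_changes⟩ := exists_block_partition T hn
  have hdμ_one : d * μ ^ 2 ≤ 1 :=
    hdμ.trans_le (mul_le_one₀ hθ_le (by positivity) (min_le_left _ _))
  have hw : ENNReal.ofReal (2 * κ * μ ^ 2) < v₀ :=
    (ENNReal.ofReal_le_ofReal (by gcongr)).trans_lt hv
  have h_information (t : ℕ) (ht : t < T) : ((Finset.range t).filter fun s => b s = b t).card *
      (I₀ * (2 * κ * μ ^ 2) ^ 2) ≤ 1 / 2 :=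
    calc _ ≤ (n : ℝ) * (I₀ * (2 * κ * μ ^ 2) ^ 2) := by
          gcongr
          exact h_size t ht
      _ = I₀ * (2 * κ * (μ ^ 2 * √n)) ^ 2 := by
          linear_combination -(I₀ * (2 * κ * μ ^ 2) ^ 2) * Real.sq_sqrt (Nat.cast_nonneg n)
      _ ≤ I₀ * (2 * κ * θ) ^ 2 := by gcongr
      _ ≤ 1 / 2 := hI
  have h_variation : 2 * κ * (d * μ ^ 2) ≤ d / √n := by
    rw [hdμ, ← mul_assoc]
    exact (mul_le_of_le_one_left (by positivity) hκθ).trans (min_le_right _ _)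
  obtain ⟨σ, hσ⟩ := h.exists_le_regret_blockEnv hα.le hμ hdμ_one hF hI₀ hw h_information A
  have h_env : IsEnvironment α β B T S Δ (blockEnv a κ μ b σ) :=
    h.isEnvironment_blockEnv hα.le hμ hdμ_one (le_trans (by gcongr) hS)
      (le_trans (by gcongr) hΔ) σ
  refine le_trans (EReal.coe_le_coe_iff.2 (le_trans (le_of_eq ?_) hσ))
    (le_iSup₂ (f := fun f (_ : IsEnvironment α β B T S Δ f) => (regret A F T f : EReal)) _ h_env)
  rw [hdμ]
  ring

lemma rpow_two_thirds_mul_pow_three {x y z : ℝ} (hx : 0 ≤ x) (hy : 0 ≤ y) (hz : 0 ≤ z) :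
    (x ^ (2 / 3 : ℝ) * y ^ (1 / 3 : ℝ) * z ^ (2 / 3 : ℝ)) ^ 3 = x ^ 2 * y * z ^ 2 := by
  rw [mul_pow, mul_pow, ← Real.rpow_mul_natCast hx, ← Real.rpow_mul_natCast hy,
    ← Real.rpow_mul_natCast hz]
  norm_num

lemma exists_sqrt_natCast_mem_Icc {r : ℝ} (hr : 1 ≤ r) :
    ∃ n : ℕ, 0 < n ∧ √(n : ℝ) ∈ Set.Icc r (2 * r) := by
  refine ⟨⌈r ^ 2⌉₊, Nat.ceil_pos.2 (by positivity), Real.le_sqrt_of_sq_le (Nat.le_ceil _),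
    Real.sqrt_le_iff.2 ⟨by positivity, ?_⟩⟩
  nlinarith [Nat.ceil_lt_add_one (sq_nonneg r)]

-- The length `n ≈ (d T / M) ^ 2` makes `T * (d / √n)` of order `M`; the bounds on `M ^ 2` and
-- `M ^ 3` then limit the number of blocks and the total variation.
lemma exists_blockLength_of_pow_le {d T S : ℕ} {Δ M : ℝ} (hd : 0 < d) (hM : 0 < M)
    (hMT : M ≤ T) (hM_sq : M ^ 2 ≤ d ^ 2 * (S * T)) (hM_cube : M ^ 3 ≤ d ^ 2 * Δ * T ^ 2) :
    ∃ n : ℕ, 0 < n ∧ 1 + (T - 1) / n ≤ S ∧ ((T - 1) / n : ℕ) * (d / √n) ≤ Δ ∧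
      M ≤ 2 * (T * min 1 (d / √n)) := by
  have hd' : (1 : ℝ) ≤ d := Nat.one_le_cast.2 hd
  have hT' : (0 : ℝ) < T := hM.trans_le hMT
  have hT : 0 < T := Nat.cast_pos.1 hT'
  obtain ⟨r, hr⟩ : ∃ r, M * r = d * T := ⟨d * T / M, mul_div_cancel₀ _ hM.ne'⟩
  have hr_one : 1 ≤ r := le_of_mul_le_mul_left (by nlinarith) hM
  obtain ⟨n, hn, hrn, hnr⟩ := exists_sqrt_natCast_mem_Icc hr_one
  have hn_sqrt : 0 < √(n : ℝ) := by linarith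
  have hn_sq : √(n : ℝ) ^ 2 = n := Real.sq_sqrt (Nat.cast_nonneg n)
  refine ⟨n, hn, ?_, ?_, ?_⟩
  · have h_sq : (T : ℝ) ≤ S * r ^ 2 := by
      refine le_of_mul_le_mul_left ?_ (by positivity : 0 < M ^ 2 * T)
      calc M ^ 2 * T * T ≤ d ^ 2 * (S * T) * T * T := by gcongr
        _ = M ^ 2 * T * (S * r ^ 2) := by linear_combination -(S * T * (M * r + d * T)) * hr
    have h_le : (T : ℝ) ≤ S * n := by
      rw [← hn_sq]
      exact h_sq.trans (by gcongr)
    have : T ≤ S * n := by exact_mod_cast h_le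
    have : (T - 1) / n < S := (Nat.div_lt_iff_lt_mul hn).2 (by omega)
    omega
  · have h_cube : T * d ≤ Δ * r ^ 3 := by
      refine le_of_mul_le_mul_left ?_ (by positivity : 0 < M ^ 3)
      calc M ^ 3 * (T * d) ≤ d ^ 2 * Δ * T ^ 2 * (T * d) := by gcongr
        _ = Δ * (d * T) ^ 3 := by ring
        _ = M ^ 3 * (Δ * r ^ 3) := by rw [← hr]; ring
    have : 0 ≤ Δ * r ^ 3 := le_trans (by positivity) h_cube
    calc ((T - 1) / n : ℕ) * (d / √n) ≤ (T : ℝ) / n * (d / √n) := by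
          gcongr
          exact Nat.cast_div_le.trans (by gcongr; exact Nat.sub_le T 1)
      _ = T * d / √n ^ 3 := by rw [div_mul_div_comm, pow_succ, hn_sq]
      _ ≤ Δ * r ^ 3 / r ^ 3 := by gcongr
      _ = Δ := mul_div_cancel_right₀ _ (by positivity)
  · rw [mul_min_of_nonneg _ _ hT'.le, mul_one, mul_min_of_nonneg _ _ zero_le_two, le_min_iff]
    refine ⟨by linarith, ?_⟩
    rw [← mul_div_assoc, ← mul_div_assoc, le_div_iff₀ hn_sqrt]
    nlinarith

lemma exists_blockLength {d T S : ℕ} {Δ M : ℝ} (hd : 0 < d) (hT : 0 < T) (hS : 0 < S)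
    (hΔ : 0 ≤ Δ) (hMT : M ≤ T) (hMS : M ≤ d * √(S * T))
    (hMΔ : M ≤ (d : ℝ) ^ (2 / 3 : ℝ) * Δ ^ (1 / 3 : ℝ) * (T : ℝ) ^ (2 / 3 : ℝ)) :
    ∃ n : ℕ, 0 < n ∧ 1 + (T - 1) / n ≤ S ∧ ((T - 1) / n : ℕ) * (d / √n) ≤ Δ ∧
      M ≤ 2 * (T * min 1 (d / √n)) := by
  rcases le_or_gt M 0 with hM | hM
  · have h_div : (T - 1) / T = 0 := Nat.div_eq_of_lt (by omega)
    refine ⟨T, hT, by omega, ?_, hM.trans (by positivity)⟩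
    rwa [h_div, Nat.cast_zero, zero_mul]
  have hM_sq : M ^ 2 ≤ d ^ 2 * (S * T) := by
    rw [← Real.sq_sqrt (by positivity : (0 : ℝ) ≤ S * T), ← mul_pow]
    gcongr
  have hM_cube : M ^ 3 ≤ d ^ 2 * Δ * T ^ 2 := by
    rw [← rpow_two_thirds_mul_pow_three (Nat.cast_nonneg d) hΔ T.cast_nonneg]
    gcongr
  exact exists_blockLength_of_pow_le hd hM hMT hM_sq hM_cube

lemma min_le_of_sq_mul_min_le {d T S : ℕ} {Δ : ℝ} (hΔ : 0 ≤ Δ)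
    (h : (d : ℝ) ^ 2 * min (S : ℝ) Δ ≤ T) :
    min ((d : ℝ) * √((S : ℝ) * T))
      ((d : ℝ) ^ (2 / 3 : ℝ) * Δ ^ (1 / 3 : ℝ) * (T : ℝ) ^ (2 / 3 : ℝ)) ≤ T := by
  have hT : (0 : ℝ) ≤ T := Nat.cast_nonneg T
  rcases le_total (S : ℝ) Δ with hSΔ | hSΔ
  · rw [min_eq_left hSΔ] at h
    refine (min_le_left _ _).trans (le_of_pow_le_pow_left₀ two_ne_zero hT ?_)
    rw [mul_pow, Real.sq_sqrt (by positivity)]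
    nlinarith
  · rw [min_eq_right hSΔ] at h
    refine (min_le_right _ _).trans (le_of_pow_le_pow_left₀ three_ne_zero hT ?_)
    rw [rpow_two_thirds_mul_pow_three (Nat.cast_nonneg d) hΔ hT]
    nlinarith [mul_le_mul_of_nonneg_right h (sq_nonneg (T : ℝ))]

lemma exists_mul_le_dynRegret.{u} (hα : 0 < α) (hαβ : α < β) (hB : α / 4 < B) (hI₀ : 0 ≤ I₀)
    (hv₀ : 0 < v₀) :
    ∃ c : ℝ, 0 < c ∧ ∀ (F : Measure ℝ) [IsProbabilityMeasure F], KLCondition F I₀ v₀ →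
      ∀ (d T S : ℕ) (Δ : ℝ), 0 < d → 0 < T → 0 < S → 0 ≤ Δ → ∀ M : ℝ, M ≤ T →
        M ≤ d * √(S * T) →
        M ≤ (d : ℝ) ^ (2 / 3 : ℝ) * Δ ^ (1 / 3 : ℝ) * (T : ℝ) ^ (2 / 3 : ℝ) →
      ∀ (U : Type u) [MeasurableSpace U] (A : RandomizedAlgorithm d U),
        ((c * M : ℝ) : EReal) ≤ dynRegret A F α β B T S Δ := by
  obtain ⟨c, hc, h⟩ := exists_le_dynRegret_of_blockLength hα hαβ hB hI₀ hv₀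
  refine ⟨c / 2, half_pos hc, fun F _ hF d T S Δ hd hT hS hΔ M hMT hMS hMΔ U _ A => ?_⟩
  obtain ⟨n, hn, hnS, hnΔ, hM⟩ := exists_blockLength hd hT hS hΔ hMT hMS hMΔ
  refine le_trans (EReal.coe_le_coe_iff.2 ?_) (h F hF d T S n Δ hd hn hnS hnΔ U A)
  calc c / 2 * M ≤ c / 2 * (2 * (T * min 1 (d / √n))) := by gcongr
    _ = c * (T * min 1 (d / √n)) := by ring

end Parameters

end BanditLB

theorem mainTheorem3 (α β B I₀ : ℝ) (v₀ : ℝ≥0∞) (hα : 0 < α) (hαβ : α < β) (hB : α / 4 < B)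
    (hI₀ : 0 < I₀) (hv₀ : 0 < v₀) :
    ∃ c : ℝ, 0 < c ∧
      ∀ (F : Measure ℝ) [IsProbabilityMeasure F], BanditLB.KLCondition F I₀ v₀ →
      ∀ (d T S : ℕ) (Δ : ℝ), 1 ≤ d → 1 ≤ T → 1 ≤ S → 0 ≤ Δ →
      ∀ (U : Type*) [MeasurableSpace U] (A : BanditLB.RandomizedAlgorithm d U),
        ((c * min (T : ℝ) (min ((d : ℝ) * Real.sqrt ((S : ℝ) * (T : ℝ)))
              ((d : ℝ) ^ (2 / 3 : ℝ) * Δ ^ (1 / 3 : ℝ) * (T : ℝ) ^ (2 / 3 : ℝ))) : ℝ) : EReal)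
            ≤ BanditLB.dynRegret A F α β B T S Δ ∧
        ((d : ℝ) ^ 2 * min (S : ℝ) Δ ≤ (T : ℝ) →
          ((c * min ((d : ℝ) * Real.sqrt ((S : ℝ) * (T : ℝ)))
              ((d : ℝ) ^ (2 / 3 : ℝ) * Δ ^ (1 / 3 : ℝ) * (T : ℝ) ^ (2 / 3 : ℝ)) : ℝ) : EReal)
            ≤ BanditLB.dynRegret A F α β B T S Δ) := by
  obtain ⟨c, hc, h⟩ := BanditLB.exists_mul_le_dynRegret hα hαβ hB hI₀.le hv₀
  refine ⟨c, hc, fun F _ hF d T S Δ hd hT hS hΔ U _ A => ⟨?_, fun hT₀ => ?_⟩⟩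
  · exact h F hF d T S Δ hd hT hS hΔ _ (min_le_left _ _)
      ((min_le_right _ _).trans (min_le_left _ _)) ((min_le_right _ _).trans (min_le_right _ _)) U A
  · exact h F hF d T S Δ hd hT hS hΔ _ (BanditLB.min_le_of_sq_mul_min_le hΔ hT₀)
      (min_le_left _ _) (min_le_right _ _) U A
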